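/- Let $n\ge 4$ and let $d=(d_1,\dots,d_n)$ be a degree sequence, that is, a sequence of integers $d_1\ge d_2\ge\cdots\ge d_n$ with $d_i\in\{1,\dots,n-1\}$ for every $i$ and $\sum_i d_i$ even. Put $m=\frac12\sum_i d_i$, let $\mu_1$ be the number of indices $i$ with $d_i=1$, and let $\mu_{odd}$ be the number of indices $i$ for which $d_i$ is odd and $d_i>1$. A cactus is a connected simple graph in which every edge belongs to at most one cycle; a core cactus is a cactus in which there is no bridge whose removal leaves two components that both contain a cycle; a core bi-cactus is a core cactus that is bipartite. Suppose that $d_4\ge 2$, $\sum_i d_i>2n$ and $\mu_1>0$. Then there is a core bi-cactus $G$ on the vertex set $\{1,\dots,n\}$ with $\deg_G(i)=d_i$ for every $i$ if and only if $$\mu_1\ge\mu_{odd}\qquad\text{and}\qquad m\le\left\lfloor\frac{4(n-1)-\mu_1}{3}\right\rfloor .$$ -/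

import Mathlib

/-- Each edge lies on at most one cycle; a cycle, as a subgraph, is identified with its
edge set. -/
def SimpleGraph.IsCactus {V : Type*} (G : SimpleGraph V) : Prop :=
  G.Connected ∧
    ∀ (e : Sym2 V) (u v : V) (p : G.Walk u u) (q : G.Walk v v),
      p.IsCycle → q.IsCycle → e ∈ p.edges → e ∈ q.edges → p.edgeSet = q.edgeSet

/-- A cactus in which no bridge splits the graph into two components each of which contains a
cycle. (Deleting a bridge of a connected graph leaves exactly two components.) -/
def SimpleGraph.IsCoreCactus {V : Type*} (G : SimpleGraph V) : Prop :=
  G.IsCactus ∧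
    ∀ e ∈ G.edgeSet, G.IsBridge e →
      ¬ ∀ C : (G.deleteEdges {e}).ConnectedComponent, ¬ C.toSimpleGraph.IsAcyclic

/-- A core cactus that is bipartite. -/
def SimpleGraph.IsCoreBiCactus {V : Type*} (G : SimpleGraph V) : Prop :=
  G.IsCoreCactus ∧ G.IsBipartite

/-- A nonincreasing sequence `d 0 ≥ d 1 ≥ ⋯ ≥ d (n - 1)` of integers in `{1, …, n - 1}` with
even sum. (Indices start at `0`, so `d i` is the term usually written `d_{i+1}`.) -/
def IsDegreeSequence {n : ℕ} (d : Fin n → ℕ) : Prop :=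
  Antitone d ∧ (∀ i, 1 ≤ d i ∧ d i ≤ n - 1) ∧ Even (∑ i, d i)

open Classical in
/-- Vertex `i` of `G` has degree `d i`, for every `i`. -/
def Realizes {n : ℕ} (G : SimpleGraph (Fin n)) (d : Fin n → ℕ) : Prop :=
  ∀ i, G.degree i = d i

/-- The number `m` of edges prescribed by `d`: half of its sum (which is even for a degree
sequence). -/
def numEdges {n : ℕ} (d : Fin n → ℕ) : ℕ := (∑ i, d i) / 2

/-- `μ₁`: the number of terms equal to `1`. -/
def muOne {n : ℕ} (d : Fin n → ℕ) : ℕ := (Finset.univ.filter fun i => d i = 1).card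

/-- `μ_odd`: the number of odd terms that are larger than `1`. -/
def muOdd {n : ℕ} (d : Fin n → ℕ) : ℕ :=
  (Finset.univ.filter fun i => Odd (d i) ∧ 1 < d i).card

/-! Necessity (`card_bounds`). Take a spanning tree of a core bi-cactus. The fundamental cycles of
the m - n + 1 remaining edges are pairwise edge-disjoint, and bipartiteness gives each at least 4
edges. The edges B on none of them are bridges, and distinct leaves lie on distinct bridges, so m ≥
4(m - n + 1) + μ₁, which is the edge bound. No bridge separates two cycle vertices, so all of these
lie in one component of the tree minus B, and |B| is at most the number of vertices off the cycles.
Since every vertex has even degree in the union of the cycles, comparing its degree with its number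
of bridges and summing over the vertices gives μ_odd ≤ μ₁.

Sufficiency. Leaves are stripped from the degree multiset (`pendant_induction`) until it consists of
3k + 1 even degrees, which are those of k quadrilaterals glued in a tree-like way
(`quadrilateral_induction`). Read backwards, this builds a graph by attaching quadrilaterals and
then leaves. The invariant `HasCore` speaks of even subgraphs because parity at the new vertices
decides how such a subgraph meets an attached piece. It implies the cactus property because a cycle
is a minimal nonempty even subgraph: two cycles sharing an edge have a nonempty even intersection,
hence coincide. -/

/-- The number of odd terms larger than `1`. -/
abbrev Multiset.oddCount (s : Multiset ℕ) : ℕ := s.countP fun x => Odd x ∧ 1 < x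

/-! ### Reducing degree multisets. -/

namespace Multiset

/-- An even term other than 2 is at least 4, so a small sum forces many 2s. -/
theorem four_mul_card_le_sum_add_count_two {s : Multiset ℕ} (h : ∀ x ∈ s, Even x ∧ 2 ≤ x) :
    4 * s.card ≤ s.sum + 2 * s.count 2 := by
  induction s using Multiset.induction with
  | empty => simp
  | cons a s ih =>
    have h1 := ih fun x hx => h x (mem_cons_of_mem hx)
    obtain ⟨⟨k, hk⟩, ha⟩ := h a (mem_cons_self a s)
    simp only [card_cons, sum_cons, count_cons]
    split_ifs <;> omega

theorem sum_le_two_mul_card {s : Multiset ℕ} (h : ∀ x ∈ s, x ≤ 2) :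
    s.sum ≤ 2 * s.card := by
  induction s using Multiset.induction with
  | empty => simp
  | cons a s ih =>
    have h1 := ih fun x hx => h x (mem_cons_of_mem hx)
    have := h a (mem_cons_self a s)
    simp only [card_cons, sum_cons]
    omega

/-- Only the 1s lie below 3, each by 2; hence a small sum without 2s forces many 1s. -/
theorem three_mul_card_le_sum_add_count_one {s : Multiset ℕ} (h : ∀ x ∈ s, 1 ≤ x)
    (h2 : 2 ∉ s) : 3 * s.card ≤ s.sum + 2 * s.count 1 := by
  induction s using Multiset.induction with
  | empty => simp
  | cons a s ih =>
    have h1 := ih (fun x hx => h x (mem_cons_of_mem hx)) fun h => h2 (mem_cons_of_mem h)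
    have := h a (mem_cons_self a s)
    have : a ≠ 2 := fun h => h2 (h ▸ mem_cons_self a s)
    simp only [card_cons, sum_cons, count_cons]
    split_ifs <;> omega

theorem mem_replicate_two_of_sum {s : Multiset ℕ} (h : ∀ x ∈ s, 2 ≤ x)
    (hs : s.sum ≤ 2 * s.card) : s = replicate s.card 2 := by
  refine eq_replicate_card.2 ?_
  induction s using Multiset.induction with
  | empty => simp
  | cons a s ih =>
    have h1 : ∀ x ∈ s, 2 ≤ x := fun x hx => h x (mem_cons_of_mem hx)
    have h2 : s.card * 2 ≤ s.sum := by simpa using s.card_nsmul_le_sum h1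
    have ha := h a (mem_cons_self a s)
    simp only [card_cons, sum_cons] at hs
    intro x hx
    rcases mem_cons.1 hx with rfl | hx
    · omega
    · exact ih h1 (by omega) x hx

theorem even_sum_add_count_one_add_oddCount (s : Multiset ℕ) :
    Even (s.sum + s.count 1 + s.oddCount) := by
  induction s using Multiset.induction with
  | empty => simp
  | cons a s ih =>
    simp only [oddCount, sum_cons, count_cons, countP_cons, Nat.even_iff, Nat.odd_iff] at ih ⊢
    split_ifs <;> omega

/-- Induction principle for the degree sequences of bridgeless trees of quadrilaterals. -/
theorem quadrilateral_induction {E : Multiset ℕ → Prop} (h0 : E {0})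
    (hear : ∀ a s, E (a ::ₘ s) → E ((a + 2) ::ₘ 2 ::ₘ 2 ::ₘ 2 ::ₘ s)) (c : ℕ) :
    ∀ s : Multiset ℕ, (∀ x ∈ s, Even x ∧ 2 ≤ x) → s.card = 3 * (c + 1) + 1 →
      s.sum = 2 * s.card + 2 * c → E s := by
  induction c with
  | zero =>
    intro s hs hcard hsum
    have := mem_replicate_two_of_sum (fun x hx => (hs x hx).2) (by omega)
    rw [this, hcard]
    exact hear 0 0 h0
  | succ c ih =>
    intro s hs hcard hsum
    obtain ⟨a, has, ha⟩ : ∃ a ∈ s, 2 < a := by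
      by_contra! hcon
      have := sum_le_two_mul_card hcon
      omega
    -- The sum exceeds twice the cardinality by 2(c + 1), so at most c + 1 of the 3c + 7 terms
    -- exceed 2, leaving more than three 2s.
    have hcount := four_mul_card_le_sum_add_count_two hs
    obtain ⟨t, rfl⟩ := exists_cons_of_mem has
    rw [count_cons_of_ne (by omega)] at hcount
    obtain ⟨r, rfl⟩ := le_iff_exists_add.1 (le_count_iff_replicate_le.1
      (show 3 ≤ t.count 2 by omega))
    have e : a ::ₘ (replicate 3 2 + r) = (a - 2 + 2) ::ₘ 2 ::ₘ 2 ::ₘ 2 ::ₘ r := by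
      rw [Nat.sub_add_cancel ha.le]; simp [replicate_succ]
    rw [e]
    apply hear
    simp only [card_cons, sum_cons, card_add, sum_add, card_replicate, sum_replicate,
      smul_eq_mul] at hcard hsum
    obtain ⟨⟨k, hk⟩, -⟩ := hs a (by simp)
    refine ih _ ?_ (by simp only [card_cons]; omega) (by simp only [card_cons, sum_cons]; omega)
    intro x hx
    rcases mem_cons.1 hx with rfl | hx
    · exact ⟨⟨k - 1, by omega⟩, by omega⟩
    · exact hs x (by simp [hx])

/-- Induction principle for the degree sequences of quadrilateral trees with pendant trees. -/
theorem pendant_induction {E P : Multiset ℕ → Prop} (h0 : E {0})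
    (hear : ∀ a s, E (a ::ₘ s) → E ((a + 2) ::ₘ 2 ::ₘ 2 ::ₘ 2 ::ₘ s)) (hEP : ∀ s, E s → P s)
    (hpend : ∀ a s, P (a ::ₘ s) → P ((a + 1) ::ₘ 1 ::ₘ s)) (c N : ℕ) :
    ∀ s : Multiset ℕ, s.card = N → (∀ x ∈ s, 1 ≤ x) → s.sum = 2 * s.card + 2 * c →
      s.oddCount ≤ s.count 1 → 3 * (c + 1) + 1 + s.count 1 ≤ s.card →
      (s.count 1 = 0 → s.card = 3 * (c + 1) + 1) → P s := by
  induction N using Nat.strong_induction_on with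
  | _ N ih =>
  intro s hN hpos hsum hodd hcard hzero
  by_cases h1 : s.count 1 = 0
  · refine hEP s (quadrilateral_induction h0 hear c s (fun x hx => ?_) (hzero h1) hsum)
    have hx1 : x ≠ 1 := by
      rintro rfl
      exact count_eq_zero.1 h1 hx
    have h := hpos x hx
    have : ¬ (Odd x ∧ 1 < x) := countP_eq_zero.1 (by omega : s.oddCount = 0) x hx
    exact ⟨Nat.not_odd_iff_even.1 fun ho => this ⟨ho, by omega⟩, by omega⟩
  obtain ⟨t, rfl⟩ := exists_cons_of_mem (count_pos.1 (Nat.pos_of_ne_zero h1))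
  simp only [oddCount, mem_cons, forall_eq_or_imp, card_cons, sum_cons, count_cons,
    countP_cons, if_true] at hpos hsum hodd hcard hzero hN
  norm_num at hodd hzero
  -- With slack in the vertex bound, a leaf is stripped from a vertex of degree 2, which becomes a
  -- leaf itself: the number of 1s is unchanged and the slack drops by one.
  by_cases hleaf : 3 * (c + 1) + 1 + (t.count 1 + 1) < t.card + 1 ∧ 2 ∈ t
  · obtain ⟨hlt, h2⟩ := hleaf
    obtain ⟨r, rfl⟩ := exists_cons_of_mem h2
    rw [cons_swap]
    apply hpend
    simp only [oddCount, mem_cons, forall_eq_or_imp, card_cons, sum_cons, count_cons,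
      countP_cons, if_true] at *
    norm_num [Nat.odd_iff] at *
    refine ih (r.card + 1) (by omega) _ (by simp) ?_ ?_ ?_ ?_ ?_ <;>
      simp <;> omega
  -- The other two moves preserve the slack and consume at most two 1s. Slack without any 2 means at
  -- least four 1s in all, so the 1s cannot run out while slack remains.
  have hmany : t.count 1 + 1 + 3 * (c + 1) + 1 < t.card + 1 → 3 ≤ t.count 1 := by
    intro hlt
    have := three_mul_card_le_sum_add_count_one (s := t) hpos.2 fun h2 => hleaf ⟨by omega, h2⟩
    omega
  by_cases ho : t.oddCount = 0
  · obtain ⟨a, hat, ha⟩ : ∃ a ∈ t, 2 < a := by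
      by_contra! hcon
      have := sum_le_two_mul_card hcon
      omega
    have hae : Even a := by
      by_contra hae
      exact countP_eq_zero.1 ho a hat ⟨Nat.not_even_iff_odd.1 hae, by omega⟩
    -- Without larger odd terms, parity of the sum supplies a second 1. Two leaves are stripped from
    -- the even term `a ≥ 4`, which stays even and at least 2.
    have heven := even_sum_add_count_one_add_oddCount t
    obtain ⟨u, rfl⟩ := exists_cons_of_mem (count_pos.1 (show 0 < t.count 1 by grind))
    obtain ⟨r, rfl⟩ := exists_cons_of_mem ((mem_cons.1 hat).resolve_left (by omega))
    obtain ⟨b, rfl⟩ : ∃ b, a = b + 2 + 1 + 1 := ⟨a - 4, by grind⟩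
    have e : (1 : ℕ) ::ₘ 1 ::ₘ (b + 2 + 1 + 1) ::ₘ r =
        (b + 2 + 1 + 1) ::ₘ 1 ::ₘ 1 ::ₘ r := by
      rw [cons_swap 1 (b + 2 + 1 + 1), cons_swap 1 (b + 2 + 1 + 1)]
    rw [e]
    refine hpend _ _ (hpend _ _ ?_)
    simp only [oddCount, mem_cons, forall_eq_or_imp, card_cons, sum_cons, count_cons,
      countP_cons, if_true] at *
    norm_num [Nat.odd_iff, Nat.even_iff] at *
    refine ih (r.card + 1) (by omega) _ (by simp) ?_ ?_ ?_ ?_ ?_ <;>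
      clear ih h0 hear hEP hpend <;> simp [countP_cons] <;> grind [count_eq_zero_of_notMem]
  · obtain ⟨a, hat, hao, ha⟩ := countP_pos.1 (Nat.pos_of_ne_zero ho)
    obtain ⟨r, rfl⟩ := exists_cons_of_mem hat
    -- Stripping one leaf from an odd term `a ≥ 3` makes it even and at least 2, so both sides of
    -- the parity inequality drop by one.
    obtain ⟨b, rfl⟩ : ∃ b, a = b + 2 + 1 := ⟨a - 3, by grind⟩
    rw [cons_swap]
    refine hpend _ _ ?_
    simp only [oddCount, mem_cons, forall_eq_or_imp, card_cons, sum_cons, count_cons,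
      countP_cons, if_true] at *
    norm_num [Nat.odd_iff, Nat.even_iff] at *
    refine ih (r.card + 1) (by omega) _ (by simp) ?_ ?_ ?_ ?_ ?_ <;>
      clear ih h0 hear hEP hpend <;> simp [countP_cons] <;> grind [count_eq_zero_of_notMem]

end Multiset

/-! ### Even subgraphs and the invariant of the construction. -/

namespace SimpleGraph

open Finset

section Valency

variable {V : Type*} [Fintype V]

open Classical in
/-- The degree of a vertex, as a sum over all vertices. -/
noncomputable def valency (G : SimpleGraph V) (v : V) : ℕ := ∑ w, if G.Adj v w then 1 else 0

theorem valency_eq_degree (G : SimpleGraph V) (v : V) [Fintype (G.neighborSet v)] :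
    G.valency v = G.degree v := by
  classical
  rw [valency, ← card_filter, ← card_neighborFinset_eq_degree]
  congr 1
  ext w
  simp

/-- All degrees of `F` are even. -/
def IsEven (F : SimpleGraph V) : Prop := ∀ v, Even (F.valency v)

/-- `G` is a connected bipartite graph whose even subgraphs are closed under intersection and
cover only vertices of `K`, and no edge separates two vertices of `K`. -/
structure HasCore (G : SimpleGraph V) (K : Set V) : Prop where
  connected : G.Connected
  colorable : ∃ f : V → Bool, ∀ v w, G.Adj v w → f v ≠ f w
  isEven_inf : ∀ F₁ ≤ G, ∀ F₂ ≤ G, F₁.IsEven → F₂.IsEven → (F₁ ⊓ F₂).IsEven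
  mem_core : ∀ F ≤ G, F.IsEven → ∀ v w, F.Adj v w → v ∈ K
  reachable : ∀ e, ∀ v ∈ K, ∀ w ∈ K, (G.deleteEdges {e}).Reachable v w

open Classical in
theorem HasCore.comap_equiv {W : Type*} [Fintype W] {G : SimpleGraph V} {K : Set V}
    (h : G.HasCore K) (e : W ≃ V) : (G.comap e).HasCore (e ⁻¹' K) := by
  have hval : ∀ F : SimpleGraph W, ∀ v, (F.comap e.symm).valency v = F.valency (e.symm v) :=
    fun F v => Equiv.sum_comp e.symm fun w => if F.Adj (e.symm v) w then 1 else 0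
  have hle : ∀ F ≤ G.comap e, F.comap e.symm ≤ G := fun F hF v w hvw => by
    simpa using hF hvw
  have heven : ∀ F : SimpleGraph W, F.IsEven ↔ (F.comap e.symm).IsEven := fun F =>
    ⟨fun hF v => hval F v ▸ hF _, fun hF w => by simpa [hval] using hF (e w)⟩
  refine ⟨?_, ?_, ?_, ?_, ?_⟩
  · exact (Iso.connected_iff (Iso.comap e G)).2 h.connected
  · obtain ⟨f, hf⟩ := h.colorable
    exact ⟨f ∘ e, fun v w hvw => hf _ _ hvw⟩
  · intro F₁ h₁ F₂ h₂ e₁ e₂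
    exact (heven _).2 (h.isEven_inf _ (hle _ h₁) _ (hle _ h₂) ((heven _).1 e₁) ((heven _).1 e₂))
  · intro F hF hFe v w hvw
    exact h.mem_core _ (hle F hF) ((heven F).1 hFe) (e v) (e w) (by simpa using hvw)
  · intro s v hv w hw
    have := h.reachable (s.map e) _ hv _ hw
    let φ : (G.deleteEdges {s.map e}) →g ((G.comap e).deleteEdges {s}) :=
      { toFun := e.symm
        map_rel' := by
          intro a b hab
          simp only [deleteEdges_adj, Set.mem_singleton_iff, comap_adj,
            Equiv.apply_symm_apply] at hab ⊢
          refine ⟨hab.1, ?_⟩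
          rintro rfl
          simp at hab }
    simpa [φ] using this.map φ

end Valency

/-! ### Attaching a graph at one vertex. -/

section Glue

variable {V W : Type*} (G : SimpleGraph V) (H : SimpleGraph W) (u : V) (S : Set W)

/-- The disjoint union of `G` and `H` together with the edges between `u` and `S`. -/
def glue : SimpleGraph (V ⊕ W) where
  Adj
    | .inl a, .inl b => G.Adj a b
    | .inr a, .inr b => H.Adj a b
    | .inl a, .inr b => a = u ∧ b ∈ S
    | .inr a, .inl b => b = u ∧ a ∈ S
  symm := ⟨by
    rintro (a | a) (b | b) h
    · exact h.symm
    · exact h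
    · exact h
    · exact h.symm⟩
  loopless := ⟨by
    rintro (a | a) h
    · exact G.loopless.irrefl a h
    · exact H.loopless.irrefl a h⟩

@[simp] theorem glue_inl_inl (a b : V) :
    (glue G H u S).Adj (.inl a) (.inl b) ↔ G.Adj a b := .rfl
@[simp] theorem glue_inr_inr (a b : W) :
    (glue G H u S).Adj (.inr a) (.inr b) ↔ H.Adj a b := .rfl
@[simp] theorem glue_inl_inr (a : V) (b : W) :
    (glue G H u S).Adj (.inl a) (.inr b) ↔ a = u ∧ b ∈ S := .rfl
@[simp] theorem glue_inr_inl (a : W) (b : V) :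
    (glue G H u S).Adj (.inr a) (.inl b) ↔ b = u ∧ a ∈ S := .rfl

variable {G H u S}

theorem comap_inl_le_of_le_glue {F : SimpleGraph (V ⊕ W)} (hF : F ≤ glue G H u S) :
    F.comap Sum.inl ≤ G := fun _ _ h => hF h

theorem reachable_glue_deleteEdges {a b : V}
    (h : ∀ e, (G.deleteEdges {e}).Reachable a b) (e : Sym2 (V ⊕ W)) :
    ((glue G H u S).deleteEdges {e}).Reachable (.inl a) (.inl b) := by
  obtain ⟨e₀, he⟩ : ∃ e₀ : Sym2 V, ∀ x y, s(Sum.inl x, Sum.inl y) = e → s(x, y) = e₀ := by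
    by_cases h : ∃ e₀ : Sym2 V, e₀.map Sum.inl = e
    · obtain ⟨e₀, rfl⟩ := h
      exact ⟨e₀, fun x y hxy => Sym2.map.injective Sum.inl_injective hxy⟩
    -- If `e` does not come from `V`, the loop is a dummy whose deletion changes nothing.
    · exact ⟨s(a, a), fun x y hxy => (h ⟨s(x, y), hxy⟩).elim⟩
  let φ : (G.deleteEdges {e₀}) →g ((glue G H u S).deleteEdges {e}) :=
    { toFun := Sum.inl
      map_rel' := by
        intro x y hxy
        simp only [deleteEdges_adj, Set.mem_singleton_iff, glue_inl_inl] at hxy ⊢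
        exact ⟨hxy.1, fun h => hxy.2 (he _ _ h)⟩ }
  exact (h e₀).map φ

/-- The colouring of the attached part is flipped when necessary, so that `S` gets the colour
opposite to that of `u`. -/
theorem exists_coloring_glue (hG : ∃ f : V → Bool, ∀ v w, G.Adj v w → f v ≠ f w)
    (g : W → Bool) (hg : ∀ v w, H.Adj v w → g v ≠ g w) (hS : ∀ w ∈ S, g w = true) :
    ∃ f : V ⊕ W → Bool, ∀ v w, (glue G H u S).Adj v w → f v ≠ f w := by
  obtain ⟨f, hf⟩ := hG
  refine ⟨Sum.elim f fun w => xor (g w) (f u), ?_⟩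
  rintro (a | a) (b | b) h
  · exact hf _ _ h
  · obtain ⟨rfl, h⟩ := h
    simp [hS b h]
  · obtain ⟨rfl, h⟩ := h
    simp [hS a h]
  · simpa using hg _ _ h

variable [Fintype V] [Fintype W]

open Classical in
theorem valency_inl (F : SimpleGraph (V ⊕ W)) (a : V) :
    F.valency (.inl a) =
      (F.comap Sum.inl).valency a + ∑ w, if F.Adj (.inl a) (.inr w) then 1 else 0 := by
  rw [valency, Fintype.sum_sum_type]
  rfl

open Classical in
theorem valency_inr {F : SimpleGraph (V ⊕ W)} (hF : F ≤ glue G H u S) (b : W) :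
    F.valency (.inr b) = (if F.Adj (.inr b) (.inl u) then 1 else 0) +
      ∑ w, if F.Adj (.inr b) (.inr w) then 1 else 0 := by
  rw [valency, Fintype.sum_sum_type]
  congr 1
  rw [Finset.sum_eq_single u]
  · intro c _ hc
    rw [if_neg]
    intro h
    exact hc (hF h).1
  · simp

open Classical in
theorem map_valency_glue {a : ℕ} {s : Multiset ℕ} (hu : G.valency u = a)
    (hs : (univ : Finset V).val.map G.valency = a ::ₘ s) :
    (univ : Finset (V ⊕ W)).val.map (glue G H u S).valency =
      ((a + ∑ w : W, if w ∈ S then 1 else 0) ::ₘ s) +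
        (univ : Finset W).val.map fun w => (glue G H u S).valency (.inr w) := by
  have e : (univ : Finset (V ⊕ W)).val =
      (univ : Finset V).val.map Sum.inl + (univ : Finset W).val.map Sum.inr := rfl
  rw [e, Multiset.map_add, Multiset.map_map, Multiset.map_map]
  congr 1
  have hV : (univ : Finset V).val = u ::ₘ (univ.erase u).val := by
    rw [← Finset.insert_val_of_notMem (by simp), Finset.insert_erase (mem_univ u)]
  rw [hV, Multiset.map_cons, hu] at hs
  rw [hV, Multiset.map_cons, ← (Multiset.cons_inj_right a).1 hs]
  have hcomap : (glue G H u S).comap Sum.inl = G := by ext; simp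
  congr 1
  · simp [valency_inl, hcomap, hu]
  · refine Multiset.map_congr rfl fun x hx => ?_
    have : x ≠ u := (Finset.mem_erase.1 hx).1
    simp [valency_inl, hcomap, this]

end Glue

end SimpleGraph

/-! ### Leaves and quadrilaterals preserve the invariant. -/

namespace SimpleGraph

open Finset

section Glue

variable {V : Type*} [Fintype V] {G : SimpleGraph V} {K : Set V}

/-- `G` with a new leaf attached at `u`. -/
abbrev addLeaf (G : SimpleGraph V) (u : V) : SimpleGraph (V ⊕ Unit) := glue G ⊥ u Set.univ

/-- `G` with a new quadrilateral attached at `u`. -/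
abbrev addQuadrilateral (G : SimpleGraph V) (u : V) : SimpleGraph (V ⊕ Fin 3) :=
  glue G (pathGraph 3) u {0, 2}

/-- The new vertex has at most one edge, so evenness leaves it none. -/
theorem not_adj_of_isEven_of_le_addLeaf {u : V} {F : SimpleGraph (V ⊕ Unit)}
    (hF : F ≤ addLeaf G u) (he : F.IsEven) (a : V) : ¬ F.Adj (.inl a) (.inr ()) := by
  intro h
  obtain rfl : a = u := (hF h).1
  simpa [valency_inr hF, h.symm] using he (.inr ())

theorem isEven_comap_of_le_addLeaf {u : V} {F : SimpleGraph (V ⊕ Unit)}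
    (hF : F ≤ addLeaf G u) (he : F.IsEven) : (F.comap Sum.inl).IsEven := by
  intro a
  simpa [valency_inl, not_adj_of_isEven_of_le_addLeaf hF he a] using he (.inl a)

theorem HasCore.addLeaf (h : G.HasCore K) (u : V) :
    (G.addLeaf u).HasCore (Sum.inl '' K) := by
  refine ⟨?_, ?_, ?_, ?_, ?_⟩
  · have hu : ∀ x, (G.addLeaf u).Reachable (.inl u) x := by
      rintro (a | a)
      · exact (h.connected u a).map ⟨Sum.inl, fun h => h⟩
      · exact Adj.reachable (by simp)
    exact (connected_iff_exists_forall_reachable _).2 ⟨.inl u, hu⟩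
  · exact exists_coloring_glue h.colorable (fun _ => true) (by simp) (by simp)
  · intro F₁ h₁ F₂ h₂ e₁ e₂ v
    have hle : F₁ ⊓ F₂ ≤ G.addLeaf u := inf_le_left.trans h₁
    have n₁ := not_adj_of_isEven_of_le_addLeaf h₁ e₁
    rcases v with a | a
    · have := h.isEven_inf _ (comap_inl_le_of_le_glue h₁) _ (comap_inl_le_of_le_glue h₂)
        (isEven_comap_of_le_addLeaf h₁ e₁) (isEven_comap_of_le_addLeaf h₂ e₂) a
      have e : (F₁ ⊓ F₂).comap Sum.inl = F₁.comap Sum.inl ⊓ F₂.comap Sum.inl := rfl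
      simpa [valency_inl, n₁, e] using this
    · rw [valency_inr hle]
      simp [adj_comm _ (Sum.inr _), n₁]
  · intro F hF he v w hvw
    have n := not_adj_of_isEven_of_le_addLeaf hF he
    rcases v with a | a <;> rcases w with b | b
    · exact ⟨a, h.mem_core _ (comap_inl_le_of_le_glue hF)
        (isEven_comap_of_le_addLeaf hF he) a b hvw, rfl⟩
    · exact (n _ hvw).elim
    · exact (n _ hvw.symm).elim
    · exact (F.irrefl hvw).elim
  · rintro e _ ⟨a, ha, rfl⟩ _ ⟨b, hb, rfl⟩
    exact reachable_glue_deleteEdges (fun e => h.reachable e a ha b hb) e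

/-- Parity at the three new vertices forces all four new edges or none; either way the parity at `u`
is that of the restriction to `G`. -/
theorem isEven_iff_of_le_addQuadrilateral {u : V} {F : SimpleGraph (V ⊕ Fin 3)}
    (hF : F ≤ addQuadrilateral G u) : F.IsEven ↔ (F.comap Sum.inl).IsEven ∧
      (F.Adj (.inl u) (.inr 0) ↔ F.Adj (.inr 0) (.inr 1)) ∧
      (F.Adj (.inr 0) (.inr 1) ↔ F.Adj (.inr 1) (.inr 2)) ∧
      (F.Adj (.inr 1) (.inr 2) ↔ F.Adj (.inl u) (.inr 2)) := by
  classical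
  have h02 : ¬ F.Adj (.inr 0) (.inr 2) := fun h => by simpa [pathGraph_adj] using hF h
  have hu1 : ¬ F.Adj (.inl u) (.inr 1) := fun h => by simpa using hF h
  have h0 := valency_inr hF 0
  have h1 := valency_inr hF 1
  have h2 := valency_inr hF 2
  have hu : ∀ a ≠ u, F.valency (.inl a) = (F.comap Sum.inl).valency a := by
    intro a ha
    rw [valency_inl]
    have : ∀ w, ¬ F.Adj (.inl a) (.inr w) := fun w h => ha (hF h).1
    simp [this]
  have hu' := valency_inl F u
  have c0 := F.adj_comm (.inr 0) (.inl u)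
  have c1 := F.adj_comm (.inr 1) (.inl u)
  have c2 := F.adj_comm (.inr 2) (.inl u)
  have c10 := F.adj_comm (.inr 1) (.inr 0)
  have c20 := F.adj_comm (.inr 2) (.inr 0)
  have c21 := F.adj_comm (.inr 2) (.inr 1)
  simp only [Fin.sum_univ_three, c0, c1, c2, c10, c20, c21, hu1, h02, SimpleGraph.irrefl,
    if_false] at h0 h1 h2 hu'
  constructor
  · intro h
    have e0 := h (.inr 0)
    have e1 := h (.inr 1)
    have e2 := h (.inr 2)
    have eu := h (.inl u)
    have key : (F.Adj (.inl u) (.inr 0) ↔ F.Adj (.inr 0) (.inr 1)) ∧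
      (F.Adj (.inr 0) (.inr 1) ↔ F.Adj (.inr 1) (.inr 2)) ∧
      (F.Adj (.inr 1) (.inr 2) ↔ F.Adj (.inl u) (.inr 2)) := by
      rw [h0] at e0; rw [h1] at e1; rw [h2] at e2
      clear * - e0 e1 e2
      split_ifs at e0 e1 e2 <;> simp_all
    refine ⟨fun a => ?_, key⟩
    by_cases ha : a = u
    · subst ha
      rw [hu', key.1, key.2.1, key.2.2] at eu
      split_ifs at eu
      · simpa [Nat.even_add_one] using eu
      · simpa using eu
    · exact hu a ha ▸ h _
  · rintro ⟨h, k0, k1, k2⟩ (a | i)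
    · by_cases ha : a = u
      · subst ha
        rw [hu', k0, k1, k2]
        split_ifs
        · simpa [Nat.even_add_one] using h a
        · simpa using h a
      · rw [hu a ha]
        exact h a
    · fin_cases i <;>
        simp only [Fin.zero_eta, Fin.mk_one, Fin.reduceFinMk, h0, h1, h2, k0, k1, k2] <;>
        split_ifs <;> simp

theorem HasCore.addQuadrilateral (h : G.HasCore Set.univ) (u : V) :
    (G.addQuadrilateral u).HasCore Set.univ := by
  have hreach : ∀ e x, ((G.addQuadrilateral u).deleteEdges {e}).Reachable (.inl u) x := by
    intro e
    have hadj : ∀ x y, (G.addQuadrilateral u).Adj x y → s(x, y) ≠ e →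
        ((G.addQuadrilateral u).deleteEdges {e}).Reachable x y := fun x y hxy hne =>
      Adj.reachable (by simpa [deleteEdges_adj] using ⟨hxy, hne⟩)
    have a0 := hadj (.inl u) (.inr 0) (by simp)
    have a1 := hadj (.inr 0) (.inr 1) (by simp [pathGraph_adj])
    have a2 := hadj (.inr 1) (.inr 2) (by simp [pathGraph_adj])
    have a3 := hadj (.inr 2) (.inl u) (by simp)
    rintro (a | i)
    · exact reachable_glue_deleteEdges (fun e => h.reachable e u trivial a trivial) e
    have key : (∀ i, ((G.addQuadrilateral u).deleteEdges {e}).Reachable (.inl u) (.inr i)) := by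
      have hne : ∀ x y : Sym2 (V ⊕ Fin 3), x ≠ y → x = e → y ≠ e := fun x y h h1 h2 =>
        h (h1.trans h2.symm)
      have d01 := hne s(.inl u, .inr 0) s(.inr 0, .inr 1) (by simp)
      have d02 := hne s(.inl u, .inr 0) s(.inr 1, .inr 2) (by simp)
      have d03 := hne s(.inl u, .inr 0) s(.inr 2, .inl u) (by simp)
      have d12 := hne s(.inr 0, .inr 1) s(.inr 1, .inr 2) (by simp)
      have d13 := hne s(.inr 0, .inr 1) s(.inr 2, .inl u) (by simp)
      have d23 := hne s(.inr 1, .inr 2) s(.inr 2, .inl u) (by simp)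
      intro i
      by_cases h0 : s(.inl u, .inr 0) = e
      · have b2 := (a3 (d03 h0)).symm
        have b1 := b2.trans (a2 (d02 h0)).symm
        have b0 := b1.trans (a1 (d01 h0)).symm
        fin_cases i <;> assumption
      · have b0 := a0 h0
        by_cases h1 : s(.inr 0, .inr 1) = e
        · have b2 := (a3 (d13 h1)).symm
          have b1 := b2.trans (a2 (d12 h1)).symm
          fin_cases i <;> assumption
        · have b1 := b0.trans (a1 h1)
          have b2 : ((G.addQuadrilateral u).deleteEdges {e}).Reachable (.inl u) (.inr 2) := by
            by_cases h2 : s(.inr 1, .inr 2) = e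
            · exact (a3 (d23 h2)).symm
            · exact b1.trans (a2 h2)
          fin_cases i <;> assumption
    exact key i
  refine ⟨?_, ?_, ?_, ?_, ?_⟩
  -- Reachability after deleting any one edge suffices; the loop is an arbitrary choice.
  · exact (connected_iff_exists_forall_reachable _).2 ⟨.inl u, fun x =>
      (hreach s(.inl u, .inl u) x).mono (deleteEdges_le _)⟩
  · refine exists_coloring_glue h.colorable (fun i => i ≠ 1) ?_ (by simp)
    intro v w hvw
    fin_cases v <;> fin_cases w <;> simp_all [pathGraph_adj]
  · intro F₁ h₁ F₂ h₂ e₁ e₂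
    have := h.isEven_inf _ (comap_inl_le_of_le_glue h₁) _ (comap_inl_le_of_le_glue h₂)
        ((isEven_iff_of_le_addQuadrilateral h₁).1 e₁).1
        ((isEven_iff_of_le_addQuadrilateral h₂).1 e₂).1
    obtain ⟨-, i0, i1, i2⟩ := (isEven_iff_of_le_addQuadrilateral h₁).1 e₁
    obtain ⟨-, j0, j1, j2⟩ := (isEven_iff_of_le_addQuadrilateral h₂).1 e₂
    refine (isEven_iff_of_le_addQuadrilateral (inf_le_left.trans h₁)).2 ⟨this, ?_, ?_, ?_⟩ <;>
      simp only [inf_adj, *]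
  · exact fun _ _ _ _ _ _ => trivial
  · exact fun e v _ w _ => (hreach e v).symm.trans (hreach e w)

theorem hasCore_of_unique [Unique V] : (⊥ : SimpleGraph V).HasCore Set.univ := by
  refine ⟨Connected.mk (fun v w => by rw [Subsingleton.elim v w]), ⟨fun _ => true, by simp⟩, ?_,
    by simp, fun e v _ w _ => by rw [Subsingleton.elim v w]⟩
  intro F₁ h₁ F₂ h₂ e₁ e₂ v
  rw [le_bot_iff.1 h₁, bot_inf_eq]
  simp [valency]

end Glue

/-- Some bridgeless graph with the properties of `HasCore` has degree multiset `s`. -/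
def BridgelessRealizable (s : Multiset ℕ) : Prop :=
  ∃ (V : Type) (_ : Fintype V) (G : SimpleGraph V), G.HasCore Set.univ ∧
    (univ : Finset V).val.map G.valency = s

/-- Some graph with the properties of `HasCore` has degree multiset `s`. -/
def CoreRealizable (s : Multiset ℕ) : Prop :=
  ∃ (V : Type) (_ : Fintype V) (G : SimpleGraph V) (K : Set V), G.HasCore K ∧
    (univ : Finset V).val.map G.valency = s

theorem bridgelessRealizable_singleton : BridgelessRealizable {0} :=
  ⟨Unit, inferInstance, ⊥, hasCore_of_unique, by simp [valency]⟩

theorem BridgelessRealizable.addQuadrilateral (a : ℕ) (s : Multiset ℕ)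
    (h : BridgelessRealizable (a ::ₘ s)) :
    BridgelessRealizable ((a + 2) ::ₘ 2 ::ₘ 2 ::ₘ 2 ::ₘ s) := by
  obtain ⟨V, _, G, hG, hs⟩ := h
  obtain ⟨u, -, hu⟩ := Multiset.mem_map.1 (hs ▸ Multiset.mem_cons_self a s)
  refine ⟨V ⊕ Fin 3, inferInstance, _, hG.addQuadrilateral u, ?_⟩
  rw [map_valency_glue hu hs]
  have e : (univ : Finset (Fin 3)).val = {0, 1, 2} := rfl
  rw [e]
  simp only [valency_inr le_rfl, Fin.sum_univ_three, Multiset.insert_eq_cons, Multiset.map_cons,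
    Multiset.map_singleton]
  simp [pathGraph_adj, Multiset.cons_add, Multiset.cons_swap _ (a + 2), add_comm s]

theorem CoreRealizable.addLeaf (a : ℕ) (s : Multiset ℕ)
    (h : CoreRealizable (a ::ₘ s)) : CoreRealizable ((a + 1) ::ₘ 1 ::ₘ s) := by
  obtain ⟨V, _, G, K, hG, hs⟩ := h
  obtain ⟨u, -, hu⟩ := Multiset.mem_map.1 (hs ▸ Multiset.mem_cons_self a s)
  refine ⟨V ⊕ Unit, inferInstance, _, _, hG.addLeaf u, ?_⟩
  rw [map_valency_glue hu hs]
  simp [valency_inr le_rfl, add_comm s]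

theorem BridgelessRealizable.coreRealizable (s : Multiset ℕ) (h : BridgelessRealizable s) :
    CoreRealizable s := by
  obtain ⟨V, _, G, hG, hs⟩ := h
  exact ⟨V, _, G, _, hG, hs⟩

/-- Equal multisets have equally large fibres over each degree, so some bijection matches the
vertices with prescribed degrees. -/
theorem CoreRealizable.exists_fin {n : ℕ} {d : Fin n → ℕ}
    (h : CoreRealizable ((univ : Finset (Fin n)).val.map d)) :
    ∃ (G : SimpleGraph (Fin n)) (K : Set (Fin n)), G.HasCore K ∧ ∀ i, G.valency i = d i := by
  classical
  obtain ⟨V, _, G, K, hG, hs⟩ := h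
  have hcard : ∀ k, Fintype.card {i // d i = k} = Fintype.card {v // G.valency v = k} := by
    intro k
    have := congrArg (Multiset.count k) hs
    rw [Multiset.count_map, Multiset.count_map] at this
    rw [Fintype.card_subtype, Fintype.card_subtype]
    simpa [Finset.card_def, eq_comm] using this.symm
  let e : Fin n ≃ V := Equiv.ofFiberEquiv fun k => Fintype.equivOfCardEq (hcard k)
  refine ⟨_, _, hG.comap_equiv e, fun i => ?_⟩
  have he : G.valency (e i) = d i := Equiv.ofFiberEquiv_map _ i
  rw [← he]
  exact Equiv.sum_comp e fun w => if G.Adj (e i) w then 1 else 0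

end SimpleGraph

/-! ### The invariant yields a core bi-cactus. -/

namespace SimpleGraph

open Finset

variable {V : Type*}

theorem valency_eq_ncard [Fintype V] (G : SimpleGraph V) (v : V) :
    G.valency v = (G.neighborSet v).ncard := by
  classical
  rw [valency_eq_degree, ← card_neighborSet_eq_degree, Set.ncard_eq_toFinset_card',
    Set.toFinset_card]

theorem IsCycles.isEven [Fintype V] {F : SimpleGraph V} (h : F.IsCycles) : F.IsEven := by
  intro v
  rw [valency_eq_ncard]
  rcases (F.neighborSet v).eq_empty_or_nonempty with h0 | h0
  · simp [h0]
  · simp [h h0]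

/-- A positive even degree bounded by 2 equals 2, so the subgraph has every edge of `F` at `a`. -/
theorem IsEven.adj_of_le_isCycles [Fintype V] {F F' : SimpleGraph V} (hle : F' ≤ F)
    (h : F.IsCycles) (he : F'.IsEven) {a b c : V} (hab : F'.Adj a b) (hac : F.Adj a c) :
    F'.Adj a c := by
  have hsub : F'.neighborSet a ⊆ F.neighborSet a := fun w hw => hle hw
  have h2 : (F.neighborSet a).ncard = 2 := h ⟨c, hac⟩
  have hpos : 0 < (F'.neighborSet a).ncard := (Set.ncard_pos (Set.toFinite _)).2 ⟨b, hab⟩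
  have heven := he a
  rw [valency_eq_ncard] at heven
  have heq := Set.eq_of_subset_of_ncard_le hsub (by grind) (Set.toFinite _)
  change c ∈ F'.neighborSet a
  rw [heq]
  exact hac

/-- Minimality of cycles: from one edge, the previous lemma propagates membership along the
connected cycle. -/
theorem Walk.IsCycle.eq_of_isEven_of_le [Fintype V] {G F : SimpleGraph V} {u : V}
    {p : G.Walk u u} (hp : p.IsCycle) (hle : F ≤ p.toSubgraph.spanningCoe) (he : F.IsEven)
    {a b : V} (hab : F.Adj a b) : F = p.toSubgraph.spanningCoe := by
  refine le_antisymm hle fun x y hxy => ?_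
  have hcyc := hp.isCycles_spanningCoe_toSubgraph
  have ha : a ∈ p.toSubgraph.verts := p.toSubgraph.edge_vert (hle hab)
  have hx : x ∈ p.toSubgraph.verts := p.toSubgraph.edge_vert hxy
  obtain ⟨q⟩ := p.toSubgraph_connected.coe.preconnected ⟨a, ha⟩ ⟨x, hx⟩
  have key : ∀ {s t : p.toSubgraph.verts} (q : p.toSubgraph.coe.Walk s t),
      (∃ z, F.Adj s z) → ∃ z, F.Adj t z := by
    intro s t q
    induction q with
    | nil => exact id
    | cons hadj _ ih =>
      rintro ⟨z, hz⟩
      exact ih ⟨_, (IsEven.adj_of_le_isCycles hle hcyc he hz hadj).symm⟩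
  obtain ⟨z, hz⟩ := key q ⟨b, hab⟩
  exact IsEven.adj_of_le_isCycles hle hcyc he hz hxy

theorem HasCore.isCactus [Fintype V] {G : SimpleGraph V} {K : Set V} (h : G.HasCore K) :
    G.IsCactus := by
  refine ⟨h.connected, ?_⟩
  intro e u v p q hp hq hep heq
  induction e using Sym2.ind with
  | _ a b =>
  have hpe := hp.isCycles_spanningCoe_toSubgraph.isEven
  have hqe := hq.isCycles_spanningCoe_toSubgraph.isEven
  have hinf := h.isEven_inf _ p.toSubgraph.spanningCoe_le _ q.toSubgraph.spanningCoe_le hpe hqe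
  have hab : (p.toSubgraph.spanningCoe ⊓ q.toSubgraph.spanningCoe).Adj a b :=
    ⟨Walk.adj_toSubgraph_iff_mem_edges.2 hep, Walk.adj_toSubgraph_iff_mem_edges.2 heq⟩
  have hEq := (hp.eq_of_isEven_of_le inf_le_left hinf hab).symm.trans
    (hq.eq_of_isEven_of_le inf_le_right hinf hab)
  ext e
  induction e using Sym2.ind with
  | _ x y =>
  have : p.toSubgraph.spanningCoe.Adj x y ↔ q.toSubgraph.spanningCoe.Adj x y := by rw [hEq]
  simpa only [Subgraph.spanningCoe_adj, Walk.adj_toSubgraph_iff_mem_edges,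
    Walk.mem_edgeSet] using this

theorem HasCore.mem_of_isCycle [Fintype V] {G : SimpleGraph V} {K : Set V} (h : G.HasCore K)
    {u : V} {p : G.Walk u u} (hp : p.IsCycle) : u ∈ K := by
  have hadj : p.toSubgraph.Adj u p.snd := Walk.toSubgraph_adj_snd p hp.not_nil
  exact h.mem_core _ p.toSubgraph.spanningCoe_le hp.isCycles_spanningCoe_toSubgraph.isEven
    u p.snd hadj

theorem ConnectedComponent.exists_isCycle_of_not_isAcyclic {G : SimpleGraph V}
    {C : G.ConnectedComponent} (h : ¬ C.toSimpleGraph.IsAcyclic) :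
    ∃ u ∈ C.supp, ∃ p : G.Walk u u, p.IsCycle := by
  simp only [IsAcyclic, not_forall, not_not] at h
  obtain ⟨u, p, hp⟩ := h
  exact ⟨u, u.2, p.map C.toSimpleGraph_hom, hp.map Subtype.val_injective⟩

theorem HasCore.isCoreBiCactus [Fintype V] {G : SimpleGraph V} {K : Set V} (h : G.HasCore K) :
    G.IsCoreBiCactus := by
  refine ⟨⟨h.isCactus, ?_⟩, ?_⟩
  · intro e _ hb hC
    induction e using Sym2.ind with
    | _ a b =>
    -- Both ends of the bridge would stay connected to vertices of `K`, which no single edge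
    -- separates.
    have hcyc : ∀ v, ∃ u ∈ K, (G.deleteEdges {s(a, b)}).Reachable u v := by
      intro v
      obtain ⟨u, hu, p, hp⟩ := ConnectedComponent.exists_isCycle_of_not_isAcyclic
        (hC (connectedComponentMk _ v))
      exact ⟨u, h.mem_of_isCycle (hp.mapLe (deleteEdges_le _)), ConnectedComponent.exact hu⟩
    obtain ⟨u, hu, hua⟩ := hcyc a
    obtain ⟨v, hv, hvb⟩ := hcyc b
    exact isBridge_iff.1 hb ((hua.symm.trans (h.reachable _ u hu v hv)).trans hvb)
  · obtain ⟨f, hf⟩ := h.colorable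
    exact (Coloring.mk f fun {v w} hvw => hf v w hvw).colorable

end SimpleGraph

/-! ### Necessity: counting edges on cycles and bridges. -/

namespace SimpleGraph

open Finset

variable {V : Type*}

/-- `C` is the edge set of a cycle of `G`. -/
def IsCycleEdges (G : SimpleGraph V) (C : Finset (Sym2 V)) : Prop :=
  ∃ (u : V) (p : G.Walk u u), p.IsCycle ∧ ∀ e, e ∈ C ↔ e ∈ p.edges

theorem IsCycleEdges.even_card_filter [DecidableEq V] {G : SimpleGraph V}
    {C : Finset (Sym2 V)} (h : G.IsCycleEdges C) (v : V) : Even #{e ∈ C | v ∈ e} := by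
  obtain ⟨u, p, hp, hC⟩ := h
  have e : #{e ∈ C | v ∈ e} = p.edges.countP fun e => v ∈ e := by
    rw [List.countP_eq_length_filter,
      ← List.toFinset_card_of_nodup (hp.isTrail.edges_nodup.filter _)]
    congr 1
    ext e
    simp [hC]
  rw [e, hp.isTrail.even_countP_edges_iff]
  simp

theorem IsCycleEdges.subset {G : SimpleGraph V} {C : Finset (Sym2 V)} (h : G.IsCycleEdges C)
    {e : Sym2 V} (he : e ∈ C) : e ∈ G.edgeSet := by
  obtain ⟨u, p, hp, hC⟩ := h
  exact p.edges_subset_edgeSet ((hC e).1 he)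

theorem IsCycleEdges.exists_isCycle {G : SimpleGraph V} {C : Finset (Sym2 V)}
    (h : G.IsCycleEdges C) {e : Sym2 V} (he : e ∈ C) {v : V} (hv : v ∈ e) :
    ∃ p : G.Walk v v, p.IsCycle := by
  classical
  obtain ⟨u, p, hp, hC⟩ := h
  obtain ⟨w, rfl⟩ := hv
  exact ⟨p.rotate v (p.fst_mem_support_of_mem_edges ((hC _).1 he)), hp.rotate _⟩

theorem IsCactus.eq_of_isCycleEdges {G : SimpleGraph V} (hG : G.IsCactus)
    {C D : Finset (Sym2 V)} (hC : G.IsCycleEdges C) (hD : G.IsCycleEdges D) {e : Sym2 V}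
    (heC : e ∈ C) (heD : e ∈ D) : C = D := by
  obtain ⟨u, p, hp, hCp⟩ := hC
  obtain ⟨v, q, hq, hDq⟩ := hD
  have := hG.2 e u v p q hp hq ((hCp e).1 heC) ((hDq e).1 heD)
  ext x
  rw [hCp, hDq, ← Walk.mem_edgeSet, this, Walk.mem_edgeSet]

theorem exists_isCycleEdges_of_isTree [DecidableEq V] {G T : SimpleGraph V}
    (hG : G.IsBipartite) (hTG : T ≤ G) (hT : T.IsTree) {f : Sym2 V} (hf : f ∈ G.edgeSet)
    (hfT : f ∉ T.edgeSet) :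
    ∃ C, G.IsCycleEdges C ∧ f ∈ C ∧ (∀ e ∈ C, e ≠ f → e ∈ T.edgeSet) ∧ 4 ≤ #C := by
  induction f using Sym2.ind with
  | _ a b =>
  rw [mem_edgeSet] at hf
  obtain ⟨p, hp, -⟩ := hT.existsUnique_path b a
  have hpT : ∀ e ∈ (p.mapLe hTG).edges, e ∈ T.edgeSet := by
    intro e he
    rw [Walk.edges_mapLe_eq_edges] at he
    exact p.edges_subset_edgeSet he
  have hcyc : (Walk.cons hf (p.mapLe hTG)).IsCycle :=
    (Walk.cons_isCycle_iff _ _).2 ⟨(Walk.isPath_mapLe hTG).2 hp, fun h => hfT (hpT _ h)⟩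
  refine ⟨(Walk.cons hf (p.mapLe hTG)).edges.toFinset, ⟨a, _, hcyc, fun e => List.mem_toFinset⟩,
    by simp, ?_, ?_⟩
  · intro e he hne
    rw [List.mem_toFinset, Walk.edges_cons, List.mem_cons] at he
    exact hpT e (he.resolve_left hne)
  · rw [List.toFinset_card_of_nodup hcyc.isTrail.edges_nodup, Walk.length_edges]
    have h3 := hcyc.three_le_length
    obtain ⟨c⟩ := hG
    let c' : G.Coloring Bool := (recolorOfEquiv G finTwoEquiv) c
    have heven := (c'.even_length_iff_congr (Walk.cons hf (p.mapLe hTG))).2 Iff.rfl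
    rcases heven with ⟨k, hk⟩
    omega

theorem IsTree.exists_notMem_edgeSet_of_isCycleEdges {G T : SimpleGraph V} (hT : T.IsTree)
    {C : Finset (Sym2 V)} (hC : G.IsCycleEdges C) : ∃ f ∈ C, f ∉ T.edgeSet := by
  obtain ⟨u, p, hp, hC⟩ := hC
  by_contra! h
  exact hT.isAcyclic (p.transfer T fun e he => h e ((hC e).2 he)) (hp.transfer _)

theorem Connected.reachable_deleteEdges_or {G : SimpleGraph V} (hG : G.Connected) (a b x : V) :
    (G.deleteEdges {s(a, b)}).Reachable x a ∨ (G.deleteEdges {s(a, b)}).Reachable x b := by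
  obtain ⟨p⟩ := hG.preconnected x a
  generalize ha : a = a' at p
  induction p with
  | nil => exact .inl (ha ▸ Reachable.refl _)
  | @cons u v w h p ih =>
    by_cases he : s(u, v) = s(a, b)
    · rcases Sym2.eq_iff.1 he with ⟨h1, h2⟩ | ⟨h1, h2⟩
      · exact .inl (h1 ▸ ha ▸ Reachable.refl _)
      · exact .inr (h1 ▸ Reachable.refl _)
    · have hadj : (G.deleteEdges {s(a, b)}).Adj u v := by
        rw [deleteEdges_adj]
        exact ⟨h, he⟩
      subst ha
      exact (ih rfl).imp (hadj.reachable.trans ·) (hadj.reachable.trans ·)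

theorem Walk.IsCycle.not_isAcyclic_connectedComponent {G : SimpleGraph V} {u : V}
    {p : G.Walk u u} (hp : p.IsCycle) :
    ¬ (G.connectedComponentMk u).toSimpleGraph.IsAcyclic := by
  classical
  intro h
  have hs : ∀ x ∈ p.support, x ∈ (G.connectedComponentMk u).supp := fun x hx =>
    ConnectedComponent.sound ⟨(p.takeUntil x hx).reverse⟩
  refine h (p.induce _ hs) (Walk.IsCycle.of_map (f := (Embedding.induce _).toHom) ?_)
  rw [Walk.map_induce]
  exact hp

/-- Otherwise `u` and `v` represent the two components left by the bridge; both contain a cycle,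
since cycles avoid bridges. -/
theorem IsCoreCactus.reachable_of_isCycle {G : SimpleGraph V} (hG : G.IsCoreCactus) {e : Sym2 V}
    (he : e ∈ G.edgeSet) (hb : G.IsBridge e) {u v : V} {p : G.Walk u u} {q : G.Walk v v}
    (hp : p.IsCycle) (hq : q.IsCycle) : (G.deleteEdges {e}).Reachable u v := by
  by_contra huv
  refine hG.2 e he hb fun C => ?_
  have hp' : ¬ ((G.deleteEdges {e}).connectedComponentMk u).toSimpleGraph.IsAcyclic :=
    (Walk.IsCycle.toDeleteEdges G {e} hp fun y hy (hye : y = e) =>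
      hb.notMem_edges_of_isCycle hp (hye ▸ hy)).not_isAcyclic_connectedComponent
  have hq' : ¬ ((G.deleteEdges {e}).connectedComponentMk v).toSimpleGraph.IsAcyclic :=
    (Walk.IsCycle.toDeleteEdges G {e} hq fun y hy (hye : y = e) =>
      hb.notMem_edges_of_isCycle hq (hye ▸ hy)).not_isAcyclic_connectedComponent
  induction C using ConnectedComponent.ind with
  | _ x =>
  have : (G.deleteEdges {e}).Reachable x u ∨ (G.deleteEdges {e}).Reachable x v := by
    induction e using Sym2.ind with
    | _ a b =>
    rcases hG.1.1.reachable_deleteEdges_or a b x with hx | hx <;>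
    rcases hG.1.1.reachable_deleteEdges_or a b u with hu | hu <;>
    rcases hG.1.1.reachable_deleteEdges_or a b v with hv | hv <;>
    first
    | exact .inl (hx.trans hu.symm)
    | exact .inr (hx.trans hv.symm)
    | exact (huv (hu.trans hv.symm)).elim
  rcases this with h | h
  · rwa [ConnectedComponent.sound h]
  · rwa [ConnectedComponent.sound h]

/-- A trail crosses the edge only once, so the parts before and after it survive the deletion. -/
theorem Walk.IsTrail.reachable_deleteEdges {G : SimpleGraph V} {u v a b : V} {p : G.Walk u v}
    (hp : p.IsTrail) (he : s(a, b) ∈ p.edges) :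
    ((G.deleteEdges {s(a, b)}).Reachable u a ∧ (G.deleteEdges {s(a, b)}).Reachable b v) ∨
    ((G.deleteEdges {s(a, b)}).Reachable u b ∧ (G.deleteEdges {s(a, b)}).Reachable a v) := by
  induction p with
  | nil => simp at he
  | @cons u w v h p ih =>
    rw [Walk.isTrail_cons] at hp
    by_cases hew : s(a, b) = s(u, w)
    · have hreach : (G.deleteEdges {s(a, b)}).Reachable w v :=
        ⟨p.toDeleteEdges _ (by rintro x hx rfl; exact hp.2 (hew ▸ hx))⟩
      rcases Sym2.eq_iff.1 hew with ⟨rfl, rfl⟩ | ⟨rfl, rfl⟩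
      · exact .inl ⟨.refl _, hreach⟩
      · exact .inr ⟨.refl _, hreach⟩
    · rw [Walk.edges_cons, List.mem_cons] at he
      have hadj : (G.deleteEdges {s(a, b)}).Adj u w := by
        rw [deleteEdges_adj]
        exact ⟨h, fun h => hew h.symm⟩
      exact (ih hp.1 (he.resolve_left hew)).imp (.imp_left (hadj.reachable.trans ·))
        (.imp_left (hadj.reachable.trans ·))

theorem card_le_card_edgeSet_add_one_of_reachable [Finite V] {H : SimpleGraph V} {Y : Finset V}
    (h : ∀ y ∈ Y, ∀ y' ∈ Y, H.Reachable y y') : #Y ≤ Nat.card H.edgeSet + 1 := by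
  rcases Y.eq_empty_or_nonempty with rfl | ⟨y, hy⟩
  · simp
  let C := H.connectedComponentMk y
  have hC := C.connected_toSimpleGraph.card_vert_le_card_edgeSet_add_one
  have h1 : Nat.card C.toSimpleGraph.edgeSet ≤ Nat.card H.edgeSet :=
    Nat.card_le_card_of_injective _
      (Hom.mapEdgeSet.injective C.toSimpleGraph_hom Subtype.val_injective)
  have h2 : #Y ≤ Nat.card C := by
    have : (Y : Set V) ⊆ C.supp := fun y' hy' => ConnectedComponent.sound (h y' hy' y hy)
    have := Set.ncard_le_ncard this (Set.toFinite _)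
    rwa [Set.ncard_coe_finset] at this
  omega

theorem sum_card_filter_mem [Fintype V] [DecidableEq V] {B : Finset (Sym2 V)}
    (h : ∀ e ∈ B, ¬ e.IsDiag) : ∑ v, #{e ∈ B | v ∈ e} = 2 * #B := by
  have hcomm : ∑ v, #{e ∈ B | v ∈ e} = ∑ e ∈ B, #{v | v ∈ e} :=
    sum_card_bipartiteAbove_eq_sum_card_bipartiteBelow fun (v : V) (e : Sym2 V) => v ∈ e
  rw [hcomm, sum_congr rfl fun e he => ?_, sum_const, smul_eq_mul, mul_comm]
  rw [← Sym2.card_toFinset_of_not_isDiag e (h e he)]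
  congr 1
  ext v
  simp

/-- Two leaves on the same edge would form a whole component, excluded by connectedness and the
vertex `z`. -/
theorem card_filter_degree_eq_one_le [Fintype V] [DecidableEq V] {G : SimpleGraph V}
    [DecidableRel G.Adj] (hG : G.Connected) {z : V} (hz : 2 ≤ G.degree z) {B : Finset (Sym2 V)}
    (hB : ∀ e ∈ B, e ∈ G.edgeSet) (h : ∀ v, G.degree v = 1 → ∃ e ∈ B, v ∈ e) :
    #{v | G.degree v = 1} ≤ #B := by
  have : Nonempty (Sym2 V) := ⟨s(z, z)⟩
  choose! g hgB hg using h
  refine card_le_card_of_injOn g (fun v hv => hgB v (mem_filter.1 hv).2) ?_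
  intro v hv w hw hvw
  have hv1 : G.degree v = 1 := (mem_filter.1 hv).2
  have hw1 : G.degree w = 1 := (mem_filter.1 hw).2
  by_contra hne
  have hvg := hg v hv1
  have hwg : w ∈ g v := hvw ▸ hg w hw1
  have heq : g v = s(v, w) := (Sym2.mem_and_mem_iff hne).1 ⟨hvg, hwg⟩
  have hadj : G.Adj v w := by
    rw [← mem_edgeSet, ← heq]
    exact hB _ (hgB v hv1)
  have huniq : ∀ {x y z}, G.degree x = 1 → G.Adj x y → G.Adj x z → z = y := by
    intro x y z hx hxy hxz
    obtain ⟨t, ht⟩ := card_eq_one.1 ((G.card_neighborFinset_eq_degree x).trans hx)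
    have h1 : y ∈ G.neighborFinset x := by simpa
    have h2 : z ∈ G.neighborFinset x := by simpa
    rw [ht, mem_singleton] at h1 h2
    rw [h1, h2]
  obtain ⟨p⟩ := hG.preconnected v z
  have key : ∀ {s t} (p : G.Walk s t), (s = v ∨ s = w) → (t = v ∨ t = w) := by
    intro s t p
    induction p with
    | nil => exact id
    | cons h _ ih =>
      rintro (rfl | rfl)
      · exact ih (.inr (huniq hv1 hadj h))
      · exact ih (.inl (huniq hw1 hadj.symm h))
  rcases key p (.inl rfl) with rfl | rfl <;> omega

/-- The numerical constraints satisfied by the degrees of a core bi-cactus. -/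
theorem IsCoreBiCactus.card_bounds [Fintype V] [DecidableEq V] {G : SimpleGraph V}
    [DecidableRel G.Adj] (hG : G.IsCoreBiCactus) {z : V} (hz : 2 ≤ G.degree z) :
    #{v | Odd (G.degree v) ∧ 1 < G.degree v} ≤ #{v | G.degree v = 1} ∧
      3 * #G.edgeFinset + 4 + #{v | G.degree v = 1} ≤ 4 * Fintype.card V := by
  classical
  obtain ⟨⟨⟨hconn, hcact⟩, hcore⟩, hbip⟩ := hG
  have hcc : G.IsCactus := ⟨hconn, hcact⟩
  obtain ⟨T, hTG, hT⟩ := hconn.exists_isTree_le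
  have hTcard := hT.card_edgeFinset
  have hTE : T.edgeFinset ⊆ G.edgeFinset := edgeFinset_subset_edgeFinset.2 hTG
  set N := G.edgeFinset \ T.edgeFinset with hN
  have hcyc : ∀ f ∈ N, ∃ C, G.IsCycleEdges C ∧ f ∈ C ∧ (∀ e ∈ C, e ≠ f → e ∈ T.edgeSet) ∧
      4 ≤ #C := fun f hf => by
    rw [hN, mem_sdiff, mem_edgeFinset, mem_edgeFinset] at hf
    exact exists_isCycleEdges_of_isTree hbip hTG hT hf.1 hf.2
  choose! C hC hfC hCT hC4 using hcyc
  have hdisj : (N : Set (Sym2 V)).PairwiseDisjoint C := by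
    intro f hf g hg hfg
    rw [Function.onFun, Finset.disjoint_left]
    intro e hef heg
    have hEq := hcc.eq_of_isCycleEdges (hC f hf) (hC g hg) hef heg
    have hgT : g ∈ T.edgeSet := hCT f hf g (hEq ▸ hfC g hg) (Ne.symm hfg)
    exact (mem_sdiff.1 hg).2 (mem_edgeFinset.2 hgT)
  set K := N.biUnion C with hK
  have hKG : K ⊆ G.edgeFinset := by
    intro e he
    obtain ⟨f, hf, hef⟩ := mem_biUnion.1 he
    exact mem_edgeFinset.2 ((hC f hf).subset hef)
  set B := G.edgeFinset \ K with hB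
  have hBG : ∀ e ∈ B, e ∈ G.edgeSet := fun e he => mem_edgeFinset.1 (mem_sdiff.1 he).1
  have hNK : N ⊆ K := fun f hf => mem_biUnion.2 ⟨f, hf, hfC f hf⟩
  have hBT : B ⊆ T.edgeFinset := by
    intro e he
    by_contra hne
    exact (mem_sdiff.1 he).2 (hNK (mem_sdiff.2 ⟨(mem_sdiff.1 he).1, hne⟩))
  -- Any cycle contains a non-tree edge `f`, hence is the fundamental cycle `C f` and lies in `K`.
  have hbridge : ∀ e ∈ B, G.IsBridge e := by
    intro e he
    rw [isBridge_iff_forall_cycle_notMem (hBG e he)]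
    intro u p hp hep
    have hD : G.IsCycleEdges p.edges.toFinset := ⟨u, p, hp, fun _ => List.mem_toFinset⟩
    obtain ⟨f, hfD, hfT⟩ := hT.exists_notMem_edgeSet_of_isCycleEdges hD
    have hf : f ∈ N := mem_sdiff.2 ⟨mem_edgeFinset.2 (hD.subset hfD),
      fun h => hfT (mem_edgeFinset.1 h)⟩
    have hEq := hcc.eq_of_isCycleEdges hD (hC f hf) hfD (hfC f hf)
    exact (mem_sdiff.1 he).2 (mem_biUnion.2 ⟨f, hf, hEq ▸ List.mem_toFinset.2 hep⟩)
  have hdeg : ∀ v, #{e ∈ B | v ∈ e} + #{e ∈ K | v ∈ e} = G.degree v := by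
    intro v
    rw [← card_incidenceFinset_eq_degree, incidenceFinset_eq_filter,
      ← card_union_of_disjoint (disjoint_filter_filter sdiff_disjoint), ← filter_union,
      sdiff_union_of_subset hKG]
  have hKeven : ∀ v, Even #{e ∈ K | v ∈ e} := by
    intro v
    rw [hK, filter_biUnion, card_biUnion]
    · exact Finset.even_sum _ fun f hf => (hC f hf).even_card_filter v
    · intro f hf g hg hfg
      exact disjoint_filter_filter (hdisj hf hg hfg)
  have hcardBK : #B + #K = #G.edgeFinset := card_sdiff_add_card_eq_card hKG
  have hcardN : #N + #T.edgeFinset = #G.edgeFinset := card_sdiff_add_card_eq_card hTE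
  have hcardK : #N * 4 ≤ #K := by
    rw [hK, card_biUnion hdisj]
    exact card_nsmul_le_sum _ _ _ hC4
  have hleaves : #{v | G.degree v = 1} ≤ #B := by
    refine card_filter_degree_eq_one_le hconn hz hBG fun v hv => ?_
    have h1 := hdeg v
    have h2 := hKeven v
    obtain ⟨e, he⟩ := card_pos.1 (show 0 < #{e ∈ B | v ∈ e} by grind)
    exact ⟨e, (mem_filter.1 he).1, (mem_filter.1 he).2⟩
  set Y : Finset V := {v | ∃ e ∈ K, v ∈ e} with hY
  have hYcyc : ∀ y ∈ Y, ∃ p : G.Walk y y, p.IsCycle := by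
    intro y hy
    obtain ⟨e, he, hye⟩ := (mem_filter.1 hy).2
    obtain ⟨f, hf, hef⟩ := mem_biUnion.1 he
    exact (hC f hf).exists_isCycle hef hye
  -- A bridge on the tree path between two cycle vertices would separate them, contrary to the core
  -- condition.
  have hreach : ∀ y ∈ Y, ∀ y' ∈ Y, (T.deleteEdges B).Reachable y y' := by
    intro y hy y' hy'
    obtain ⟨q, hq⟩ := hYcyc y hy
    obtain ⟨q', hq'⟩ := hYcyc y' hy'
    obtain ⟨p, hp, -⟩ := hT.existsUnique_path y y'
    refine ⟨p.toDeleteEdges _ fun e hep heB => ?_⟩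
    have heB : e ∈ B := heB
    have hr := IsCoreCactus.reachable_of_isCycle ⟨hcc, hcore⟩ (hBG e heB) (hbridge e heB) hq hq'
    have hb := hbridge e heB
    induction e using Sym2.ind with
    | _ a b =>
    have hle : T.deleteEdges {s(a, b)} ≤ G.deleteEdges {s(a, b)} := deleteEdges_mono hTG
    refine isBridge_iff.1 hb ?_
    rcases hp.isTrail.reachable_deleteEdges hep with ⟨h1, h2⟩ | ⟨h1, h2⟩
    · exact ((h1.mono hle).symm.trans hr).trans (h2.mono hle).symm
    · exact (h2.mono hle).trans (hr.symm.trans (h1.mono hle))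
  have hYcard : #Y + #B ≤ #T.edgeFinset + 1 := by
    have h1 := card_le_card_edgeSet_add_one_of_reachable hreach
    have h2 : Nat.card (T.deleteEdges B).edgeSet = #(T.edgeFinset \ B) := by
      rw [Nat.card_coe_set_eq, ← Set.ncard_coe_finset]
      congr 1
      simp
    have h3 := card_sdiff_add_card_eq_card hBT
    omega
  have hsum : ∑ v, #{e ∈ B | v ∈ e} = 2 * #B :=
    sum_card_filter_mem fun e he => G.not_isDiag_of_mem_edgeSet (hBG e he)
  -- On a cycle, an odd degree requires an odd number of bridges. Off the cycles all edges are
  -- bridges, and a leaf is compensated by the last term. Summing and using |B| ≤ |Yᶜ| gives the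
  -- parity inequality.
  have hpoint : ∀ v, (if Odd (G.degree v) ∧ 1 < G.degree v then 1 else 0) +
      2 * (if v ∈ Yᶜ then 1 else 0) ≤
        #{e ∈ B | v ∈ e} + if G.degree v = 1 then 1 else 0 := by
    intro v
    have h1 := hdeg v
    have h2 := hKeven v
    have hpos : 0 < G.degree v := by
      have : Nontrivial V := by
        by_contra hnt
        rw [not_nontrivial_iff_subsingleton] at hnt
        have := G.degree_lt_card_verts z
        have := Fintype.card_le_one_iff_subsingleton.2 hnt
        omega
      exact hconn.preconnected.degree_pos_of_nontrivial v
    by_cases hv : v ∈ Y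
    · have h3 : 0 < #{e ∈ K | v ∈ e} := by
        obtain ⟨e, he, hve⟩ := (mem_filter.1 hv).2
        exact card_pos.2 ⟨e, mem_filter.2 ⟨he, hve⟩⟩
      rw [if_neg (fun h => mem_compl.1 h hv)]
      grind
    · have h3 : #{e ∈ K | v ∈ e} = 0 := by
        rw [card_eq_zero, filter_eq_empty_iff]
        exact fun e he hve => hv (mem_filter.2 ⟨mem_univ v, e, he, hve⟩)
      rw [if_pos (mem_compl.2 hv)]
      grind
  have htotal := sum_le_sum fun v (_ : v ∈ univ) => hpoint v
  rw [sum_add_distrib, sum_add_distrib, ← mul_sum, hsum, ← card_filter, ← card_filter,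
    ← card_filter] at htotal
  have hYc : #{v | v ∈ Yᶜ} + #Y = Fintype.card V := by
    rw [filter_mem_eq_inter, univ_inter, card_compl_add_card]
  constructor <;> omega

end SimpleGraph

/-! ### Assembling both directions. -/

theorem numEdges_le_floor_iff {n : ℕ} (d : Fin n → ℕ) :
    (numEdges d : ℤ) ≤ ⌊(4 * ((n : ℚ) - 1) - (muOne d : ℚ)) / 3⌋ ↔
      3 * numEdges d + 4 + muOne d ≤ 4 * n := by
  rw [Int.le_floor, le_div_iff₀ (by norm_num), ← Nat.cast_le (α := ℚ)]
  push_cast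
  constructor <;> intro h <;> linarith

theorem two_mul_numEdges {n : ℕ} {d : Fin n → ℕ} (hd : IsDegreeSequence d) :
    2 * numEdges d = ∑ i, d i :=
  Nat.two_mul_div_two_of_even hd.2.2

theorem coreRealizable_of_isDegreeSequence {n : ℕ} {d : Fin n → ℕ} (hd : IsDegreeSequence d)
    (hsum : 2 * n ≤ ∑ i, d i) (hone : 0 < muOne d) (hodd : muOdd d ≤ muOne d)
    (hm : 3 * numEdges d + 4 + muOne d ≤ 4 * n) :
    SimpleGraph.CoreRealizable ((Finset.univ : Finset (Fin n)).val.map d) := by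
  have h2 := two_mul_numEdges hd
  have hcount : ((Finset.univ : Finset (Fin n)).val.map d).count 1 = muOne d := by
    rw [Multiset.count_map, muOne, Finset.card_def, Finset.filter_val]
    simp only [eq_comm]
  have hoddc : ((Finset.univ : Finset (Fin n)).val.map d).oddCount = muOdd d := by
    rw [Multiset.oddCount, Multiset.countP_map, muOdd, Finset.card_def, Finset.filter_val]
  -- The parameter `numEdges d - n` is the number of cycles minus one; `hsum` makes the subtraction
  -- exact.
  refine Multiset.pendant_induction SimpleGraph.bridgelessRealizable_singleton
    SimpleGraph.BridgelessRealizable.addQuadrilateral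
    SimpleGraph.BridgelessRealizable.coreRealizable SimpleGraph.CoreRealizable.addLeaf
    (numEdges d - n) n _ (by simp) ?_ ?_ (by rw [hcount, hoddc]; exact hodd) ?_ ?_
  · simp only [Multiset.mem_map, forall_exists_index, and_imp]
    rintro _ i - rfl
    exact (hd.2.1 i).1
  · change ∑ i, d i = _
    simp only [Multiset.card_map, Finset.card_val, Finset.card_univ, Fintype.card_fin]
    omega
  · rw [hcount]
    simp only [Multiset.card_map, Finset.card_val, Finset.card_univ, Fintype.card_fin]
    omega
  · rw [hcount]
    omega

theorem mainTheorem3 (n : ℕ) (hn : 4 ≤ n) (d : Fin n → ℕ) (hd : IsDegreeSequence d)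
    (hd4 : 2 ≤ d ⟨3, hn⟩) (hsum : 2 * n < ∑ i, d i) (hone : 0 < muOne d) :
    (∃ G : SimpleGraph (Fin n), Realizes G d ∧ G.IsCoreBiCactus) ↔
      muOdd d ≤ muOne d ∧
        (numEdges d : ℤ) ≤ ⌊(4 * ((n : ℚ) - 1) - (muOne d : ℚ)) / 3⌋ := by
  classical
  rw [numEdges_le_floor_iff]
  constructor
  · rintro ⟨G, hGd, hG⟩
    have hdeg : ∀ i, G.degree i = d i := fun i => by
      rw [← hGd i]
    have hE : G.edgeFinset.card = numEdges d := by
      have h1 := G.sum_degrees_eq_twice_card_edges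
      have h2 := two_mul_numEdges hd
      simp only [hdeg] at h1
      omega
    have := hG.card_bounds (z := ⟨3, hn⟩) (by rwa [hdeg])
    simp only [hdeg, hE, Fintype.card_fin] at this
    simpa only [muOdd, muOne] using this
  · rintro ⟨hodd, hm⟩
    obtain ⟨G, K, hG, hGd⟩ :=
      (coreRealizable_of_isDegreeSequence hd hsum.le hone hodd hm).exists_fin
    exact ⟨G, fun i => by rw [← SimpleGraph.valency_eq_degree, hGd], hG.isCoreBiCactus⟩
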